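/- For a discrete group $G$, let $C^*(G)$ denote its full group $C^*$-algebra, i.e. the completion of $\ell^1(G)$ (equivalently, of the group algebra $\mathbb{C}[G]$) in the norm $\|f\|_u=\sup_\pi\|\pi(f)\|$, where $\pi$ runs through the $*$-representations on Hilbert spaces (equivalently, the integrated forms of the unitary representations of $G$). A *group-lattice pair* $(G,A)$ consists of a group $G$ and a finitely generated abelian normal subgroup $A\trianglelefteq G$ of finite index; $G/A$ is called its *point group*. Let $\widehat{A}=\operatorname{Hom}(A,\mathbb{T})$, on which $G/A$ acts by $(gA\cdot\chi)(a)=\chi(g^{-1}ag)$. The pair $(G,A)$ is *crystal-like* if there is some $\chi\in\widehat{A}$ whose orbit $\mathcal{O}_\chi$ under this action satisfies $|\mathcal{O}_\chi|=[G:A]$. **Corollary.** Let $G$ and $H$ be discrete, finitely generated groups such that $C^*(G)\cong C^*(H)$ (as $C^*$-algebras, i.e. $*$-isomorphic). If $(G,A_G)$ and $(H,A_H)$ are crystal-like group-lattice pairs, then $[G:A_G]=[H:A_H]$; that is, the point groups $G/A_G$ and $H/A_H$ have the same order. -/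

import Mathlib

open scoped ENNReal

noncomputable section

universe u

/-- A unitary representation of the discrete group `G` on a non-zero complex Hilbert space.
The Hilbert spaces range over the universe of `G`. This is no restriction on the universal norm
below: a cyclic representation of `G` is a completion of a quotient of the group algebra `ℂ[G]`,
so it has a copy in the universe of `G`, and the norm of `π(f)` is the supremum of the norms of its
restrictions to the cyclic subrepresentations of `π`. -/
structure UnitaryRep (G : Type u) [Group G] : Type (u + 1) where
  space : Type u
  [normedAddCommGroup : NormedAddCommGroup space]
  [innerProductSpace : InnerProductSpace ℂ space]
  [completeSpace : CompleteSpace space]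
  [nontrivial : Nontrivial space]
  hom : G →* unitary (space →L[ℂ] space)

namespace UnitaryRep

attribute [instance] normedAddCommGroup innerProductSpace completeSpace nontrivial

variable {G : Type u} [Group G]

/-- The bounded operators on the space of the representation. -/
abbrev Op (π : UnitaryRep G) : Type u := π.space →L[ℂ] π.space

/-- The extension of a unitary representation to the group algebra:
`π(f) = ∑ g, f(g) π(g)`. -/
def integrated (π : UnitaryRep G) : MonoidAlgebra ℂ G →ₐ[ℂ] π.Op :=
  MonoidAlgebra.lift ℂ π.Op G ((unitary π.Op).subtype.comp π.hom)

end UnitaryRep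

section GroupCStar

variable (G : Type u) [Group G]

/-- The C*-algebra of all bounded families `(T_π)`, `T_π ∈ B(H_π)`, with the supremum norm and
pointwise operations; `π` runs through all unitary representations of `G`. -/
def UniversalOp : Type (u + 1) := lp (fun π : UnitaryRep G => π.Op) ∞

namespace UniversalOp

instance : NormedRing (UniversalOp G) :=
  inferInstanceAs (NormedRing (lp (fun π : UnitaryRep G => π.Op) ∞))

instance : StarRing (UniversalOp G) :=
  inferInstanceAs (StarRing (lp (fun π : UnitaryRep G => π.Op) ∞))

instance : NormedAlgebra ℂ (UniversalOp G) :=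
  inferInstanceAs (NormedAlgebra ℂ (lp (fun π : UnitaryRep G => π.Op) ∞))

instance : CompleteSpace (UniversalOp G) :=
  inferInstanceAs (CompleteSpace (lp (fun π : UnitaryRep G => π.Op) ∞))

instance : CStarRing (UniversalOp G) :=
  inferInstanceAs (CStarRing (lp (fun π : UnitaryRep G => π.Op) ∞))

instance : StarModule ℂ (UniversalOp G) :=
  inferInstanceAs (StarModule ℂ (lp (fun π : UnitaryRep G => π.Op) ∞))

instance : CStarAlgebra (UniversalOp G) where

variable {G}

/-- The component at `π` of a bounded family of operators. -/
def component (π : UnitaryRep G) : UniversalOp G →⋆ₐ[ℂ] π.Op where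
  toFun T := (show lp (fun π : UnitaryRep G => π.Op) ∞ from T) π
  map_one' := rfl
  map_mul' _ _ := rfl
  map_zero' := rfl
  map_add' _ _ := rfl
  commutes' _ := rfl
  map_star' _ := rfl

theorem ext {S T : UniversalOp G} (h : ∀ π, component π S = component π T) : S = T :=
  lp.ext (funext h)

theorem norm_eq (T : UniversalOp G) : ‖T‖ = ⨆ π, ‖component π T‖ :=
  lp.norm_eq_ciSup _

theorem bddAbove_norm (T : UniversalOp G) : BddAbove (Set.range fun π => ‖component π T‖) :=
  memℓp_infty_iff.mp (lp.memℓp (show lp (fun π : UnitaryRep G => π.Op) ∞ from T))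

end UniversalOp

open UniversalOp

variable {G} in
/-- The universal representation of a group element: the family `(π(g))_π`. -/
def universalRep : G →* UniversalOp G where
  toFun g := (⟨fun π => (π.hom g : π.Op), memℓp_infty ⟨1, by
    rintro _ ⟨π, rfl⟩
    exact (CStarRing.norm_coe_unitary (π.hom g)).le⟩⟩ : lp (fun π : UnitaryRep G => π.Op) ∞)
  map_one' := UniversalOp.ext fun π => by
    exact congrArg Subtype.val (map_one π.hom)
  map_mul' g h := UniversalOp.ext fun π => by
    exact congrArg Subtype.val (map_mul π.hom g h)

variable {G} in
theorem component_universalRep (π : UnitaryRep G) (g : G) :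
    component π (universalRep g) = (π.hom g : π.Op) := rfl

/-- The *-subalgebra underlying `C*(G)`: the norm closure, in the universal representation, of the
*-algebra generated by `G`. -/
def groupCStarSubalgebra : StarSubalgebra ℂ (UniversalOp G) :=
  (StarAlgebra.adjoin ℂ (Set.range (universalRep (G := G)))).topologicalClosure

instance isClosed_groupCStarSubalgebra :
    IsClosed (groupCStarSubalgebra G : Set (UniversalOp G)) :=
  StarSubalgebra.isClosed_topologicalClosure _

/-- The full group C*-algebra `C*(G)` of the discrete group `G`: the closure of the group algebra
`ℂ[G]` in the universal representation (see `coe_groupCStarSubalgebra`). The norm on `ℂ[G]` is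
`‖f‖ = sup_π ‖π(f)‖` (see `norm_universalRepAlg`), so this is the completion of `ℂ[G]`,
equivalently of `ℓ¹(G)`, in the universal norm. -/
def GroupCStar : Type (u + 1) := groupCStarSubalgebra G

instance : CStarAlgebra (GroupCStar G) :=
  inferInstanceAs (CStarAlgebra (groupCStarSubalgebra G))

/-- The inclusion of `C*(G)` in the bounded families of operators. -/
def GroupCStar.incl : GroupCStar G →⋆ₐ[ℂ] UniversalOp G where
  toFun x := (show groupCStarSubalgebra G from x).1
  map_one' := rfl
  map_mul' _ _ := rfl
  map_zero' := rfl
  map_add' _ _ := rfl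
  commutes' _ := rfl
  map_star' _ := rfl

theorem GroupCStar.isometry_incl : Isometry (GroupCStar.incl G) := fun _ _ => rfl

theorem GroupCStar.range_incl :
    Set.range (GroupCStar.incl G) = (groupCStarSubalgebra G : Set (UniversalOp G)) :=
  Subtype.range_coe

/-- The universal representation of the group algebra. -/
def universalRepAlg : MonoidAlgebra ℂ G →ₐ[ℂ] UniversalOp G :=
  MonoidAlgebra.lift ℂ (UniversalOp G) G universalRep

variable {G}

theorem component_universalRepAlg (f : MonoidAlgebra ℂ G) (π : UnitaryRep G) :
    component π (universalRepAlg G f) = π.integrated f := by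
  induction f using MonoidAlgebra.induction_on with
  | of g => simp [universalRepAlg, UnitaryRep.integrated, component_universalRep]
  | add f h hf hh => simp only [map_add, hf, hh]
  | smul r f hf => simp only [map_smul, hf]

/-- The norm of `C*(G)` restricted to the group algebra is the universal norm. -/
theorem norm_universalRepAlg (f : MonoidAlgebra ℂ G) :
    ‖universalRepAlg G f‖ = ⨆ π : UnitaryRep G, ‖π.integrated f‖ := by
  simp only [UniversalOp.norm_eq, component_universalRepAlg]

/-- The supremum in the universal norm is that of a bounded set. -/
theorem bddAbove_norm_integrated (f : MonoidAlgebra ℂ G) :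
    BddAbove (Set.range fun π : UnitaryRep G => ‖π.integrated f‖) := by
  simpa only [component_universalRepAlg] using UniversalOp.bddAbove_norm (universalRepAlg G f)

theorem star_universalRep (g : G) : star (universalRep g) = universalRep g⁻¹ :=
  UniversalOp.ext fun π => by
    rw [map_star, component_universalRep, component_universalRep, map_inv]
    rfl

/-- `C*(G)` is the closure of the image of the group algebra. -/
theorem coe_groupCStarSubalgebra :
    (groupCStarSubalgebra G : Set (UniversalOp G)) = closure (Set.range (universalRepAlg G)) := by
  have hstar : star (Set.range (universalRep (G := G))) = Set.range universalRep := by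
    ext x
    constructor
    · rintro ⟨g, hg⟩
      exact ⟨g⁻¹, by rw [← star_star x, ← hg, star_universalRep]⟩
    · rintro ⟨g, rfl⟩
      exact ⟨g⁻¹, (star_universalRep g).symm⟩
  have hadj : ((StarAlgebra.adjoin ℂ (Set.range (universalRep (G := G)))).toSubalgebra) =
      (universalRepAlg G).range := by
    rw [StarAlgebra.adjoin_toSubalgebra, hstar, Set.union_self]
    apply le_antisymm
    · rw [Algebra.adjoin_le_iff]
      rintro _ ⟨g, rfl⟩
      exact ⟨MonoidAlgebra.of ℂ G g, by simp [universalRepAlg]⟩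
    · rintro _ ⟨f, rfl⟩
      induction f using MonoidAlgebra.induction_on with
      | of g => exact Algebra.subset_adjoin ⟨g, by simp [universalRepAlg]⟩
      | add f h hf hh => simpa using add_mem hf hh
      | smul r f hf => simpa using Subalgebra.smul_mem _ hf r
  have h := congrArg (fun S : Subalgebra ℂ (UniversalOp G) => (S : Set (UniversalOp G))) hadj
  rw [groupCStarSubalgebra, StarSubalgebra.topologicalClosure_coe]
  exact congrArg closure h

end GroupCStar

/-- A group-lattice pair `(G, A)`: a finitely generated abelian normal subgroup `A` (the lattice)
of finite index in `G`. -/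
structure GroupLatticePair (G : Type u) [Group G] where
  lattice : Subgroup G
  [normal : lattice.Normal]
  [isMulCommutative : IsMulCommutative lattice]
  [finiteIndex : lattice.FiniteIndex]
  fg : lattice.FG

namespace GroupLatticePair

attribute [instance] normal isMulCommutative finiteIndex

variable {G : Type u} [Group G] (P : GroupLatticePair G)

/-- The point group `D = G ⧸ A`. -/
abbrev pointGroup : Type u := G ⧸ P.lattice

/-- The dual `Hom(A, 𝕋)` of the (discrete) lattice. -/
abbrev Dual : Type u := P.lattice →* Circle

/-- The conjugation action of `G` on the dual: `(g • χ)(a) = χ(g⁻¹ a g)`. -/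
def conjDual : G →* Equiv.Perm P.Dual where
  toFun g :=
    { toFun := fun χ => χ.comp (MulAut.conjNormal g⁻¹).toMonoidHom
      invFun := fun χ => χ.comp (MulAut.conjNormal g).toMonoidHom
      left_inv := fun χ => by ext a; simp [map_inv]
      right_inv := fun χ => by ext a; simp [map_inv] }
  map_one' := by ext χ a; simp
  map_mul' g h := by ext χ a; simp

theorem conjDual_apply (g : G) (χ : P.Dual) (a : P.lattice) :
    P.conjDual g χ a =
      χ ⟨g⁻¹ * a * g, by simpa using P.normal.conj_mem a a.2 g⁻¹⟩ := by
  refine congrArg χ (Subtype.ext ?_)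
  simp

/-- The lattice acts trivially, so the action descends to the point group. -/
def pointGroupAction : P.pointGroup →* Equiv.Perm P.Dual :=
  QuotientGroup.lift P.lattice P.conjDual (fun g hg => by
    ext χ a
    rw [conjDual_apply]
    congr 2
    apply Subtype.ext
    have h : (⟨g, hg⟩ : P.lattice) * a = a * ⟨g, hg⟩ := mul_comm' _ _
    have h' : g * (a : G) = a * g := congrArg Subtype.val h
    simp [mul_assoc, ← h'])

/-- The orbit of a character under the action of the point group. -/
def orbit (χ : P.Dual) : Set P.Dual := Set.range fun d : P.pointGroup => P.pointGroupAction d χ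

/-- The pair is crystal-like if some character of the lattice has an orbit with `[G : A]`
elements. -/
def IsCrystalLike : Prop := ∃ χ : P.Dual, (P.orbit χ).ncard = P.lattice.index

end GroupLatticePair

end

/-! For a crystal-like pair `(G, A)`, the index `[G : A]` is the largest dimension of a
finite-dimensional irreducible representation of `C*(G)`, which depends only on the algebra. Upper
bound, for any pair (`GroupCStar.finrank_le_index`): the commuting operators of `A` have a common
eigenvector, and its translates by coset representatives span an invariant subspace. Attainment
(`GroupLatticePair.inducedIsometry_irreducible`): inducing a character with an orbit of full size
gives a representation of dimension `[G : A]`, on which `A` acts diagonally by pairwise distinct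
characters; this forces irreducibility. Transporting the induced representation along the
isomorphism gives one inequality, and symmetry the other. -/

noncomputable section

/-- A commuting group of invertible operators on a non-zero finite-dimensional complex space has
a common eigenvector. -/
theorem exists_common_eigenvector {A V : Type*} [Group A] [AddCommGroup V] [Module ℂ V]
    [FiniteDimensional ℂ V] [Nontrivial V] (ρ : A → Module.End ℂ V)
    (hρ : ∀ a b, Commute (ρ a) (ρ b)) :
    ∃ v : V, v ≠ 0 ∧ ∀ a, ∃ c : ℂ, ρ a v = c • v := by
  classical
  -- Take a non-zero invariant `W` of least dimension. By commutativity each eigenspace met by `W`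
  -- cuts out an invariant subspace, so minimality makes every `ρ a` scalar on `W`.
  have hex : ∃ n, ∃ W : Submodule ℂ V, W ≠ ⊥ ∧ (∀ a, ∀ w ∈ W, ρ a w ∈ W) ∧
      Module.finrank ℂ W = n := ⟨_, ⊤, top_ne_bot, by simp, rfl⟩
  obtain ⟨W, hW, hinv, hn⟩ := Nat.find_spec hex
  obtain ⟨v, hvW, hv⟩ := W.exists_mem_ne_zero_of_ne_bot hW
  refine ⟨v, hv, fun a => ?_⟩
  have : Nontrivial W := Submodule.nontrivial_iff_ne_bot.mpr hW
  obtain ⟨c, hc⟩ := Module.End.exists_eigenvalue ((ρ a).restrict (hinv a))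
  obtain ⟨w, hw⟩ := hc.exists_hasEigenvector
  have hw' : ρ a w = c • (w : V) := congrArg Subtype.val hw.apply_eq_smul
  set U : Submodule ℂ V := W ⊓ (ρ a).eigenspace c with hU
  have hUbot : U ≠ ⊥ := fun h => hw.2 (Subtype.ext ((Submodule.eq_bot_iff _).mp h w
    ⟨w.2, Module.End.mem_eigenspace_iff.mpr hw'⟩))
  have hUinv : ∀ b, ∀ u ∈ U, ρ b u ∈ U := by
    rintro b u ⟨hu, hu'⟩
    refine ⟨hinv b u hu, Module.End.mem_eigenspace_iff.mpr ?_⟩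
    have h := LinearMap.congr_fun (hρ a b).eq u
    simp only [Module.End.mul_apply] at h
    rw [h, Module.End.mem_eigenspace_iff.mp hu', map_smul]
  have hle : Module.finrank ℂ W ≤ Module.finrank ℂ U :=
    hn ▸ Nat.find_min' hex ⟨U, hUbot, hUinv, rfl⟩
  have hUW : U = W := Submodule.eq_of_le_of_finrank_le inf_le_left hle
  exact ⟨c, Module.End.mem_eigenspace_iff.mp ((hUW ▸ hvW : v ∈ U)).2⟩

/-! ### Upper bound for the dimension of irreducible representations -/

namespace GroupCStar

variable {G : Type u} [Group G]

/-- The canonical image of a group element in `C*(G)`. -/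
def of : G →* GroupCStar G where
  toFun g := show groupCStarSubalgebra G from ⟨universalRep g,
    StarSubalgebra.le_topologicalClosure _ (StarAlgebra.subset_adjoin ℂ _ ⟨g, rfl⟩)⟩
  map_one' := (GroupCStar.isometry_incl G).injective (map_one universalRep)
  map_mul' g h := (GroupCStar.isometry_incl G).injective (map_mul universalRep g h)

theorem incl_of (g : G) : GroupCStar.incl G (of g) = universalRep g := rfl

/-- The group algebra is dense in `C*(G)`. -/
theorem denseRange_lift : DenseRange (MonoidAlgebra.lift ℂ (GroupCStar G) G of) := by
  have hcomp : ∀ f, GroupCStar.incl G (MonoidAlgebra.lift ℂ (GroupCStar G) G of f) =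
      universalRepAlg G f := by
    intro f
    induction f using MonoidAlgebra.induction_on with
    | of g => simp [universalRepAlg, incl_of]
    | add f h hf hh => simp only [map_add, hf, hh]
    | smul r f hf => simp only [map_smul, hf]
  intro x
  rw [(GroupCStar.isometry_incl G).isUniformInducing.isInducing.closure_eq_preimage_closure_image,
    Set.mem_preimage, ← Set.range_comp]
  have h : GroupCStar.incl G x ∈ (groupCStarSubalgebra G : Set (UniversalOp G)) := by
    rw [← GroupCStar.range_incl]
    exact ⟨x, rfl⟩
  rw [coe_groupCStarSubalgebra] at h
  convert h using 3
  exact funext hcomp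

/-- A subspace invariant under the image of `G` in a continuous finite-dimensional representation
of `C*(G)` is invariant under `C*(G)`. -/
theorem map_mem_of_forall_of {V : Type*} [NormedAddCommGroup V] [NormedSpace ℂ V]
    [FiniteDimensional ℂ V] (ρ : GroupCStar G →ₐ[ℂ] (V →L[ℂ] V)) (hρ : Continuous ρ)
    (W : Submodule ℂ V) (hW : ∀ g, ∀ w ∈ W, ρ (of g) w ∈ W) (x : GroupCStar G) {w : V}
    (hw : w ∈ W) : ρ x w ∈ W := by
  refine denseRange_lift.induction_on (p := fun x => ρ x w ∈ W) x ?_ fun f => ?_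
  · exact W.closed_of_finiteDimensional.preimage (hρ.clm_apply continuous_const)
  · induction f using MonoidAlgebra.induction_on with
    | of g => simpa using hW g w hw
    | add f h hf hh => simpa using W.add_mem hf hh
    | smul r f hf => simpa using W.smul_mem r hf

/-- An irreducible finite-dimensional representation of `C*(G)` has dimension at most `[G : A]`
for every group-lattice pair `(G, A)`. -/
theorem finrank_le_index (P : GroupLatticePair G) {V : Type*} [NormedAddCommGroup V]
    [NormedSpace ℂ V] [FiniteDimensional ℂ V] [Nontrivial V]
    (ρ : GroupCStar G →ₐ[ℂ] (V →L[ℂ] V)) (hρ : Continuous ρ)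
    (hirr : ∀ W : Submodule ℂ V, W ≠ ⊥ → (∀ x, ∀ w ∈ W, ρ x w ∈ W) → W = ⊤) :
    Module.finrank ℂ V ≤ P.lattice.index := by
  obtain ⟨v, hv, heig⟩ := exists_common_eigenvector
    (fun a : P.lattice => (ρ (of (a : G)) : V →ₗ[ℂ] V)) fun a b => by
      have h : (a : G) * b = b * a := congrArg Subtype.val (mul_comm' a b)
      ext w
      change (ρ (of (a : G)) * ρ (of (b : G))) w = (ρ (of (b : G)) * ρ (of (a : G))) w
      rw [← map_mul, ← map_mul, ← map_mul, ← map_mul, h]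
  set W : Submodule ℂ V :=
    Submodule.span ℂ (Set.range fun x : G ⧸ P.lattice => ρ (of x.out) v) with hWdef
  have hmem : ∀ g, ρ (of g) v ∈ W := by
    intro g
    -- `g` differs from its coset representative by a lattice element on the right, which only
    -- rescales `v`.
    obtain ⟨a, ha⟩ := QuotientGroup.mk_out_eq_mul P.lattice g
    obtain ⟨c, hc⟩ := heig a⁻¹
    have hg : g = (g : G ⧸ P.lattice).out * (a⁻¹ : P.lattice) := by simp [ha]
    have hc' : ρ (of ((a⁻¹ : P.lattice) : G)) v = c • v := hc
    rw [hg, map_mul, map_mul, mul_apply_eq_comp, hc', map_smul]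
    exact W.smul_mem c (Submodule.subset_span ⟨_, rfl⟩)
  have hinv : ∀ g, ∀ w ∈ W, ρ (of g) w ∈ W := by
    intro g w hw
    induction hw using Submodule.span_induction with
    | mem w hw =>
      obtain ⟨x, rfl⟩ := hw
      simpa using hmem (g * x.out)
    | zero => simp
    | add w w' _ _ h h' => simpa using W.add_mem h h'
    | smul c w _ h => simpa using W.smul_mem c h
  have hW : W = ⊤ := hirr W (fun h => hv (by simpa [h] using hmem 1))
    fun x w hw => map_mem_of_forall_of ρ hρ W hinv x hw
  have : Fintype (G ⧸ P.lattice) := Fintype.ofFinite _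
  calc Module.finrank ℂ V = Module.finrank ℂ W := by rw [hW, finrank_top]
    _ ≤ Fintype.card (G ⧸ P.lattice) := finrank_range_le_card _
    _ = P.lattice.index := by rw [Subgroup.index, Nat.card_eq_fintype_card]

end GroupCStar

/-! ### Representations induced from characters of the lattice -/

namespace GroupLatticePair

variable {G : Type u} [Group G] (P : GroupLatticePair G)

instance : Fintype P.pointGroup := Fintype.ofFinite _

/-- The lattice element comparing `g` with the chosen coset representatives. -/
def latticeCocycle (g : G) (x : P.pointGroup) : P.lattice :=
  ⟨x.out⁻¹ * (g * (g⁻¹ • x).out), QuotientGroup.eq.mp (by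
    rw [QuotientGroup.out_eq', ← smul_eq_mul, ← MulAction.Quotient.smul_coe,
      QuotientGroup.out_eq', smul_inv_smul])⟩

theorem coe_latticeCocycle (g : G) (x : P.pointGroup) :
    (P.latticeCocycle g x : G) = x.out⁻¹ * (g * (g⁻¹ • x).out) := rfl

theorem latticeCocycle_one (x : P.pointGroup) : P.latticeCocycle 1 x = 1 :=
  Subtype.ext (by simp [coe_latticeCocycle])

/-- The cocycle identity that makes `inducedIsometry` multiplicative. -/
theorem latticeCocycle_mul (g h : G) (x : P.pointGroup) :
    P.latticeCocycle (g * h) x = P.latticeCocycle g x * P.latticeCocycle h (g⁻¹ • x) :=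
  Subtype.ext (by simp [coe_latticeCocycle, mul_smul, mul_assoc])

theorem smul_eq_of_mem_lattice {a : G} (ha : a ∈ P.lattice) (x : P.pointGroup) : a • x = x := by
  induction x using QuotientGroup.induction_on with
  | H g =>
    rw [MulAction.Quotient.smul_coe, smul_eq_mul, eq_comm, QuotientGroup.eq]
    simpa [mul_assoc] using P.normal.conj_mem a ha g⁻¹

/-- Since `a` fixes every coset, the cocycle is conjugation of `a` by a representative of `x`. Hence
the lattice acts diagonally in the induced representation, by the conjugate `x • χ` at coordinate
`x`. -/
theorem apply_latticeCocycle (χ : P.Dual) (a : P.lattice) (x : P.pointGroup) :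
    χ (P.latticeCocycle a x) = P.pointGroupAction x χ a := by
  have h : P.pointGroupAction x χ = P.conjDual x.out χ := by
    conv_lhs => rw [← QuotientGroup.out_eq' x]
    rfl
  rw [h, conjDual_apply]
  congr 1
  apply Subtype.ext
  rw [coe_latticeCocycle, P.smul_eq_of_mem_lattice (inv_mem a.2), ← mul_assoc]

/-- The representation of `G` induced from the character `χ`, as linear isometries. -/
def inducedIsometry (χ : P.Dual) : G →* (EuclideanSpace ℂ P.pointGroup ≃ₗᵢ[ℂ]
    EuclideanSpace ℂ P.pointGroup) where
  toFun g :=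
    { toFun := fun f => WithLp.toLp 2 fun x => (χ (P.latticeCocycle g x) : ℂ) * f (g⁻¹ • x)
      invFun := fun f => WithLp.toLp 2 fun x => (χ (P.latticeCocycle g⁻¹ x) : ℂ) * f (g • x)
      map_add' := fun f f' => by ext x; simp [mul_add]
      map_smul' := fun c f => by ext x; simp [mul_left_comm]
      left_inv := fun f => by
        ext x
        have h := P.latticeCocycle_mul g⁻¹ g x
        rw [inv_mul_cancel, latticeCocycle_one, inv_inv] at h
        simp [← mul_assoc, ← Circle.coe_mul, ← map_mul, ← h]
      right_inv := fun f => by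
        ext x
        have h := P.latticeCocycle_mul g g⁻¹ x
        rw [mul_inv_cancel, latticeCocycle_one] at h
        simp [← mul_assoc, ← Circle.coe_mul, ← map_mul, ← h]
      norm_map' := fun f => by
        change ‖WithLp.toLp 2 fun x => (χ (P.latticeCocycle g x) : ℂ) * f (g⁻¹ • x)‖ = ‖f‖
        rw [EuclideanSpace.norm_eq, EuclideanSpace.norm_eq]
        congr 1
        simp only [norm_mul, Circle.norm_coe, one_mul]
        exact Equiv.sum_comp (MulAction.toPerm g⁻¹) fun x => ‖f x‖ ^ 2 }
  map_one' := by
    ext f x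
    change (χ (P.latticeCocycle 1 x) : ℂ) * f ((1 : G)⁻¹ • x) = f x
    simp [latticeCocycle_one]
  map_mul' g h := by
    ext f x
    change (χ (P.latticeCocycle (g * h) x) : ℂ) * f ((g * h)⁻¹ • x) =
      (χ (P.latticeCocycle g x) : ℂ) *
        ((χ (P.latticeCocycle h (g⁻¹ • x)) : ℂ) * f (h⁻¹ • g⁻¹ • x))
    simp [latticeCocycle_mul, mul_smul, mul_assoc]

theorem inducedIsometry_apply (χ : P.Dual) (g : G) (f : EuclideanSpace ℂ P.pointGroup)
    (x : P.pointGroup) :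
    P.inducedIsometry χ g f x = (χ (P.latticeCocycle g x) : ℂ) * f (g⁻¹ • x) := rfl

/-- The unitary representation of `G` induced from the character `χ`. -/
def inducedRep (χ : P.Dual) : UnitaryRep G where
  space := EuclideanSpace ℂ P.pointGroup
  hom := (Unitary.linearIsometryEquiv (𝕜 := ℂ)).symm.toMonoidHom.comp (P.inducedIsometry χ)

variable {P} in
theorem pointGroupAction_injective {χ : P.Dual} (hχ : (P.orbit χ).ncard = P.lattice.index) :
    Function.Injective fun d : P.pointGroup => P.pointGroupAction d χ := by
  rw [← Set.injOn_univ, ← Set.ncard_image_iff, Set.image_univ, Set.ncard_univ]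
  exact hχ

/-- If the orbit of `χ` has `[G : A]` elements, the induced representation is irreducible. -/
theorem inducedIsometry_irreducible {χ : P.Dual} (hχ : (P.orbit χ).ncard = P.lattice.index)
    (W : Submodule ℂ (EuclideanSpace ℂ P.pointGroup)) (hW : W ≠ ⊥)
    (hinv : ∀ g, ∀ w ∈ W, P.inducedIsometry χ g w ∈ W) : W = ⊤ := by
  classical
  -- Choose a non-zero vector of `W` with smallest support; it turns out to be supported at one
  -- point.
  have hex : ∃ n, ∃ w ∈ W, w ≠ 0 ∧ (Finset.univ.filter fun x => w x ≠ 0).card = n := by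
    obtain ⟨w, hw, hw0⟩ := W.exists_mem_ne_zero_of_ne_bot hW
    exact ⟨_, w, hw, hw0, rfl⟩
  obtain ⟨w, hw, hw0, hn⟩ := Nat.find_spec hex
  obtain ⟨x, hx⟩ : ∃ x, w x ≠ 0 := by
    by_contra! h
    exact hw0 (by ext x; exact h x)
  have hsupp : ∀ y, y ≠ x → w y = 0 := by
    intro y hyx
    by_contra hy
    obtain ⟨a, ha⟩ : ∃ a, P.pointGroupAction y χ a ≠ P.pointGroupAction x χ a := by
      by_contra! h
      exact hyx (pointGroupAction_injective hχ (MonoidHom.ext h))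
    -- This combination kills coordinate `x`, keeps coordinate `y` and creates no new ones, so its
    -- support is strictly smaller.
    set w' := P.inducedIsometry χ a w - (P.pointGroupAction x χ a : ℂ) • w with hw'
    have happ : ∀ z, w' z =
        ((P.pointGroupAction z χ a : ℂ) - (P.pointGroupAction x χ a : ℂ)) * w z := by
      intro z
      simp [hw', inducedIsometry_apply, apply_latticeCocycle,
        P.smul_eq_of_mem_lattice (inv_mem a.2), sub_mul]
    have hw'y : w' y ≠ 0 := by
      rw [happ]
      exact mul_ne_zero (sub_ne_zero.mpr fun h => ha (Circle.ext h)) hy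
    have hmin := Nat.find_min' hex ⟨w', W.sub_mem (hinv a w hw) (W.smul_mem _ hw),
      fun h => hw'y (by simp [h]), rfl⟩
    rw [← hn] at hmin
    refine hmin.not_gt (Finset.card_lt_card (Finset.ssubset_iff_of_subset ?_ |>.mpr
      ⟨x, by simpa using hx, by simp [happ]⟩))
    intro z hz
    simp only [Finset.mem_filter, Finset.mem_univ, true_and, happ] at hz ⊢
    exact right_ne_zero_of_mul hz
  -- `w` is a multiple of the basis vector at `x`, and `G` permutes the cosets transitively.
  have hsingle : ∀ y, EuclideanSpace.single y (1 : ℂ) ∈ W := by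
    intro y
    obtain ⟨g, rfl⟩ := MulAction.exists_smul_eq G x y
    have hne : (χ (P.latticeCocycle g (g • x)) : ℂ) * w x ≠ 0 :=
      mul_ne_zero (Circle.coe_ne_zero _) hx
    have h := W.smul_mem ((χ (P.latticeCocycle g (g • x)) : ℂ) * w x)⁻¹ (hinv g w hw)
    convert h using 1
    ext z
    rw [PiLp.smul_apply, inducedIsometry_apply, smul_eq_mul, PiLp.single_apply]
    split_ifs with hz
    · rw [hz, inv_smul_smul, inv_mul_cancel₀ hne]
    · rw [hsupp (g⁻¹ • z) fun h => hz (inv_smul_eq_iff.mp h), mul_zero, mul_zero]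
  rw [eq_top_iff, ← (EuclideanSpace.basisFun P.pointGroup ℂ).toBasis.span_eq, Submodule.span_le]
  rintro _ ⟨y, rfl⟩
  simpa using hsingle y

end GroupLatticePair

/-! ### Comparison along the isomorphism -/

open scoped CStarAlgebra in
/-- The order of the point group of a crystal-like pair for `H` is at most that of any
group-lattice pair for `G` when `C*(G) ≅ C*(H)`. -/
theorem GroupCStar.index_le_of_isCrystalLike {G : Type*} {H : Type*} [Group G] [Group H]
    (φ : GroupCStar G ≃⋆ₐ[ℂ] GroupCStar H) (P : GroupLatticePair G) (Q : GroupLatticePair H)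
    (hQ : Q.IsCrystalLike) : Q.lattice.index ≤ P.lattice.index := by
  obtain ⟨χ, hχ⟩ := hQ
  let σ : GroupCStar H →⋆ₐ[ℂ] (EuclideanSpace ℂ Q.pointGroup →L[ℂ] EuclideanSpace ℂ Q.pointGroup) :=
    (UniversalOp.component (Q.inducedRep χ)).comp (GroupCStar.incl H)
  let ρ : GroupCStar G →⋆ₐ[ℂ]
      (EuclideanSpace ℂ Q.pointGroup →L[ℂ] EuclideanSpace ℂ Q.pointGroup) :=
    σ.comp (φ : GroupCStar G →⋆ₐ[ℂ] GroupCStar H)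
  have hσ : ∀ h w, σ (GroupCStar.of h) w = Q.inducedIsometry χ h w := fun _ _ => rfl
  have hdim : Module.finrank ℂ (EuclideanSpace ℂ Q.pointGroup) = Q.lattice.index := by
    rw [finrank_euclideanSpace, Subgroup.index, Nat.card_eq_fintype_card]
  rw [← hdim]
  refine GroupCStar.finrank_le_index P ρ.toAlgHom (map_continuous ρ) fun W hW hinv => ?_
  refine Q.inducedIsometry_irreducible hχ W hW fun h w hw => ?_
  -- Surjectivity of `φ` turns invariance under `C*(G)` into invariance under `H`.
  have h' := hinv (φ.symm (GroupCStar.of h)) w hw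
  have hρ : ρ (φ.symm (GroupCStar.of h)) = σ (GroupCStar.of h) :=
    congrArg σ (φ.apply_symm_apply _)
  rw [← hσ, ← hρ]
  exact h'

end

theorem corollary4p14 {G : Type*} {H : Type*} [Group G] [Group H] [Group.FG G] [Group.FG H]
    (hiso : Nonempty (GroupCStar G ≃⋆ₐ[ℂ] GroupCStar H))
    (P : GroupLatticePair G) (Q : GroupLatticePair H)
    (hP : P.IsCrystalLike) (hQ : Q.IsCrystalLike) :
    P.lattice.index = Q.lattice.index ∧ Nat.card P.pointGroup = Nat.card Q.pointGroup := by
  obtain ⟨φ⟩ := hiso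
  have h := (GroupCStar.index_le_of_isCrystalLike φ.symm Q P hP).antisymm
    (GroupCStar.index_le_of_isCrystalLike φ P Q hQ)
  exact ⟨h, h⟩
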